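/- Consider a downlink rate-splitting system in which a base station at $x_0\in\mathbb R^3$ serves $K$ users, with power fractions $\alpha_{\mathrm c}$ for the common message and $\alpha_{\mathrm p,j}\ge 0$ for the private message of user $j$, $\alpha_{\mathrm c}+\sum_{j=1}^K\alpha_{\mathrm p,j}=1$. Fix a user $k$ at $x_k\neq x_0$, with path loss $L_k=\|x_0-x_k\|^{-\beta}$, $\beta>2$, whose fluid antenna has $N_k\ge 1$ ports with channel coefficients $h^1,\dots,h^{N_k}$ and gains $g^n=|h^n|^2$. Assume Rayleigh fading at every port (each $|h^n|$ is Rayleigh distributed) with common mean gain $\overline g=\mathbb E[g^n]$, and assume that the gains are coupled by the Student-$t$ copula with $\nu_k>0$ degrees of freedom and correlation matrix $\mathbf\Sigma_k$: for all real $s_1,\dots,s_{N_k}$, $$\Pr(g^1\le s_1,\dots,g^{N_k}\le s_{N_k})=T_{\nu_k,\mathbf\Sigma_k}\big(t_{\nu_k}^{-1}(F_{g^1}(s_1)),\dots,t_{\nu_k}^{-1}(F_{g^{N_k}}(s_{N_k}))\big),$$ where $T_{\nu,\mathbf\Sigma}$ is the CDF of the multivariate $t$-distribution (with $\mathbf\Sigma$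 positive semidefinite with unit diagonal), $t_\nu^{-1}$ is the ($[-\infty,\infty]$-valued) quantile function of the univariate $t$-distribution, and $F_{g^n}$ is the CDF of $g^n$. Let $g_{\mathrm{fas}}=\max_n g^n$ and, for average transmit SNR $\overline\gamma>0$, let $$\gamma_{\mathrm c}=\frac{\overline\gamma\,\alpha_{\mathrm c}L_kg_{\mathrm{fas}}}{\overline\gamma(1-\alpha_{\mathrm c})L_kg_{\mathrm{fas}}+1},\qquad \gamma_{\mathrm p}=\frac{\overline\gamma\,\alpha_{\mathrm p,k}L_kg_{\mathrm{fas}}}{\overline\gamma L_kg_{\mathrm{fas}}\sum_{j\ne k}\alpha_{\mathrm p,j}+1}.$$ Let $\gamma_{\mathrm{th,c}},\gamma_{\mathrm{th,p}}>0$ be thresholds with $(1-\alpha_{\mathrm c})\gamma_{\mathrm{th,c}}<\alpha_{\mathrm c}$ and $(1-\alpha_{\mathrm c}-\alpha_{\mathrm p,k})\gamma_{\mathrm{th,p}}<\alpha_{\mathrm p,k}$, let $P_{\mathrm o,k}(\overline\gamma)=1-\Pr(\gamma_{\mathrm c}>\gamma_{\mathrm{th,c}},\ \gamma_{\mathrm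 p}>\gamma_{\mathrm{th,p}})$ be the outage probability, and put $$\gamma_{\mathrm{th}}(\overline\gamma)=\max\Big\{\frac{\gamma_{\mathrm{th,c}}}{\overline\gamma L_k(\alpha_{\mathrm c}-(1-\alpha_{\mathrm c})\gamma_{\mathrm{th,c}})},\ \frac{\gamma_{\mathrm{th,p}}}{\overline\gamma L_k(\alpha_{\mathrm p,k}-(1-\alpha_{\mathrm c}-\alpha_{\mathrm p,k})\gamma_{\mathrm{th,p}})}\Big\}.$$ Then, for every $\overline\gamma>0$, $$P_{\mathrm o,k}(\overline\gamma)=T_{\nu_k,\mathbf\Sigma_k}\big(t_{\nu_k}^{-1}(1-e^{-\gamma_{\mathrm{th}}(\overline\gamma)/\overline g}),\dots,t_{\nu_k}^{-1}(1-e^{-\gamma_{\mathrm{th}}(\overline\gamma)/\overline g})\big),$$ and, as $\overline\gamma\to\infty$, one has $F_{g^n}(\gamma_{\mathrm{th}}(\overline\gamma))\sim\gamma_{\mathrm{th}}(\overline\gamma)/\overline g$ for every $n$, and $$P_{\mathrm o,k}(\overline\gamma)\sim P_{\mathrm o,k}^\infty(\overline\gamma):=T_{\nu_k,\mathbf\Sigma_k}\big(t_{\nu_k}^{-1}(\gamma_{\mathrm{th}}(\overline\gamma)/\overline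 g),\dots,t_{\nu_k}^{-1}(\gamma_{\mathrm{th}}(\overline\gamma)/\overline g)\big).$$ Here $a\sim b$ means $a-b=o(b)$, i.e. $a/b\to1$ wherever $b\ne0$ (and $a=0$ where $b=0$, for all large $\overline\gamma$). -/

import Mathlib

open MeasureTheory ProbabilityTheory Filter Asymptotics

/-! ### Student's `t` distribution and the `t` copula -/

noncomputable section

/-- The chi-square distribution with `ν` degrees of freedom, that is, the gamma distribution of
shape `ν / 2` and rate `1 / 2`. -/
def chiSquareMeasure (ν : ℝ) : Measure ℝ := gammaMeasure (ν / 2) (1 / 2)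

/-- The univariate Student `t` distribution with `ν` degrees of freedom: the law of `Z / √(W / ν)`
for independent `Z ∼ N(0, 1)` and `W ∼ χ²(ν)`. -/
def studentTMeasure (ν : ℝ) : Measure ℝ :=
  ((gaussianReal 0 1).prod (chiSquareMeasure ν)).map fun p => p.1 / √(p.2 / ν)

/-- The `N`-variate (centred) `t` distribution with `ν` degrees of freedom and matrix `S`: the law
of `Z / √(W / ν)` for independent `Z ∼ N(0, S)` and `W ∼ χ²(ν)`. -/
def multivariateTMeasure {N : ℕ} (ν : ℝ) (S : Matrix (Fin N) (Fin N) ℝ) :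
    Measure (Fin N → ℝ) :=
  ((multivariateGaussian 0 S).prod (chiSquareMeasure ν)).map fun p i => p.1 i / √(p.2 / ν)

/-- The quantile function (inverse distribution function) of the univariate `t` distribution, with
values in the extended reals: it is `⊥` at `0` and `⊤` at `1`. -/
def tQuantile (ν p : ℝ) : EReal :=
  sInf {y : EReal | ∃ x : ℝ, y = x ∧ p ≤ (studentTMeasure ν).real (Set.Iic x)}

/-- The distribution function of the multivariate `t` distribution, on the extended reals. -/
def multivariateTCDF {N : ℕ} (ν : ℝ) (S : Matrix (Fin N) (Fin N) ℝ) (x : Fin N → EReal) : ℝ :=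
  (multivariateTMeasure ν S).real {y | ∀ i, (y i : EReal) ≤ x i}

/-- The Student `t` copula. -/
def tCopula {N : ℕ} (ν : ℝ) (S : Matrix (Fin N) (Fin N) ℝ) (u : Fin N → ℝ) : ℝ :=
  multivariateTCDF ν S fun i => tQuantile ν (u i)

/-- Correlation matrices: positive semidefinite (in particular symmetric) with unit diagonal. -/
def IsCorrelationMatrix {N : ℕ} (S : Matrix (Fin N) (Fin N) ℝ) : Prop :=
  S.PosSemidef ∧ ∀ i, S i i = 1

/-- The random variables `X 1, …, X N` are coupled by the `t` copula: their joint distribution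
function is the copula evaluated at their marginal distribution functions. -/
def HasTCopula {Ω : Type*} [MeasurableSpace Ω] (P : Measure Ω) {N : ℕ} (ν : ℝ)
    (S : Matrix (Fin N) (Fin N) ℝ) (X : Fin N → Ω → ℝ) : Prop :=
  ∀ s : Fin N → ℝ,
    P.real {ω | ∀ i, X i ω ≤ s i} = tCopula ν S fun i => P.real {ω | X i ω ≤ s i}

/-! ### Rayleigh fading -/

/-- The Rayleigh distribution of scale `σ`. -/
def rayleighMeasure (σ : ℝ) : Measure ℝ :=
  volume.withDensity fun r =>
    ENNReal.ofReal (if 0 ≤ r then r / σ ^ 2 * Real.exp (-r ^ 2 / (2 * σ ^ 2)) else 0)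

/-- The complex channel coefficient `h` undergoes Rayleigh fading: its modulus is Rayleigh
distributed. -/
def IsRayleighFading {Ω : Type*} [MeasurableSpace Ω] (P : Measure Ω) (h : Ω → ℂ) : Prop :=
  ∃ σ : ℝ, 0 < σ ∧ HasLaw (fun ω => ‖h ω‖) (rayleighMeasure σ) P

/-! ### Fluid antenna system with rate splitting -/

/-- The channel gain of a port with channel coefficient `h`. -/
def channelGain {Ω : Type*} (h : Ω → ℂ) (ω : Ω) : ℝ := ‖h ω‖ ^ 2

/-- The equivalent channel gain of a fluid antenna: the gain of the best port. -/
def fasGain {Ω : Type*} {N : ℕ} [NeZero N] (h : Fin N → Ω → ℂ) (ω : Ω) : ℝ :=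
  Finset.univ.sup' Finset.univ_nonempty fun n => channelGain (h n) ω

/-- Path loss between a base station at `x₀` and a user at `x`, with exponent `β`. -/
def pathLoss (β : ℝ) (x₀ x : EuclideanSpace ℝ (Fin 3)) : ℝ := dist x₀ x ^ (-β)

/-- SINR of the common message at average transmit SNR `snr`, path loss `L`, channel gain `g`. -/
def sinrCommon (αc L snr g : ℝ) : ℝ :=
  snr * αc * L * g / (snr * (1 - αc) * L * g + 1)

/-- SINR of the private message of user `k` after the common message has been removed. -/
def sinrPrivate {K : ℕ} (αp : Fin K → ℝ) (k : Fin K) (L snr g : ℝ) : ℝ :=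
  snr * αp k * L * g / (snr * L * g * (∑ j ∈ Finset.univ.erase k, αp j) + 1)

/-- Outage probability of user `k` with port channels `h`: the probability that it is not true that
both SINRs exceed their thresholds `θc` (common message) and `θp` (private message). -/
def outageProb {Ω : Type*} [MeasurableSpace Ω] (P : Measure Ω) {K N : ℕ} [NeZero N]
    (αc : ℝ) (αp : Fin K → ℝ) (k : Fin K) (L θc θp : ℝ) (h : Fin N → Ω → ℂ) (snr : ℝ) : ℝ :=
  1 - P.real {ω | θc < sinrCommon αc L snr (fasGain h ω) ∧
    θp < sinrPrivate αp k L snr (fasGain h ω)}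

/-- The threshold for the channel gain that is equivalent to the two SINR thresholds. -/
def gainThreshold (αc αpk L θc θp snr : ℝ) : ℝ :=
  max (θc / (snr * L * (αc - (1 - αc) * θc)))
    (θp / (snr * L * (αpk - (1 - αc - αpk) * θp)))

end

open scoped Topology

/-! Each SINR is increasing in the gain, so outage means that every port gain is at most the
threshold. Squared Rayleigh moduli are exponential, and the copula then gives the exact formula. The
asymptotics rest on one monotonicity: scaling `W ∼ χ²(ν)` down by `l ≤ 1` costs at most a factor `l
^ (ν / 2)`, so `r ^ ν * Pr(all T i ≤ -r)` is nondecreasing in `r` for any `t` vector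
(`rpow_mul_prod_chiSquareMeasure_le`). In dimension one this quantity is also bounded, hence has a
limit `ℓ > 0`, and the quantile `-r(p)` satisfies `r(p) ^ ν * p → ℓ`. Thus `v ~ u` forces `(r(u) /
r(v)) ^ ν → 1`. If `v ≤ u`, the multivariate monotonicity yields `(r(u) / r(v)) ^ ν * C(u) ≤ C(v) ≤
C(u)` for the copula diagonal `C`. No positive limit for the multivariate tail is needed, so
degenerate correlation matrices are covered. -/

/-! ### Rayleigh fading and exponential gains. -/

theorem rayleighMeasure_real_sq_le {σ s : ℝ} (hσ : 0 < σ) (hs : 0 ≤ s) :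
    (rayleighMeasure σ).real {r | r ^ 2 ≤ s} = 1 - Real.exp (-(s / (2 * σ ^ 2))) := by
  have hmeas : MeasurableSet {r : ℝ | r ^ 2 ≤ s} :=
    measurableSet_le (by fun_prop) measurable_const
  have hcont : Continuous fun r : ℝ => r / σ ^ 2 * Real.exp (-r ^ 2 / (2 * σ ^ 2)) := by
    fun_prop
  have hsqrt := Real.sqrt_nonneg s
  rw [Measure.real, rayleighMeasure, withDensity_apply _ hmeas,
    ← lintegral_indicator hmeas]
  have hind : {r : ℝ | r ^ 2 ≤ s}.indicator (fun r => ENNReal.ofReal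
        (if 0 ≤ r then r / σ ^ 2 * Real.exp (-r ^ 2 / (2 * σ ^ 2)) else 0)) =
      (Set.Icc 0 √s).indicator fun r =>
        ENNReal.ofReal (r / σ ^ 2 * Real.exp (-r ^ 2 / (2 * σ ^ 2))) := by
    ext r
    by_cases h0 : 0 ≤ r
    · have hiff : r ∈ Set.Icc 0 √s ↔ r ∈ {r : ℝ | r ^ 2 ≤ s} := by
        simp [h0, Real.le_sqrt h0 hs]
      simp only [Set.indicator, hiff, h0, if_true]
    · have : r ∉ Set.Icc 0 √s := fun h => h0 h.1
      rw [Set.indicator_of_notMem this]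
      simp [Set.indicator, h0]
  have hderiv : ∀ r : ℝ, HasDerivAt (fun r => -Real.exp (-r ^ 2 / (2 * σ ^ 2)))
      (r / σ ^ 2 * Real.exp (-r ^ 2 / (2 * σ ^ 2))) r := by
    intro r
    have h1 : HasDerivAt (fun r : ℝ => -r ^ 2 / (2 * σ ^ 2)) (-(2 * r) / (2 * σ ^ 2)) r := by
      simpa using ((hasDerivAt_pow 2 r).neg.div_const (2 * σ ^ 2))
    refine h1.exp.neg.congr_deriv ?_
    rw [show -(2 * r) / (2 * σ ^ 2) = -(r / σ ^ 2) by
      rw [neg_div, mul_div_mul_left _ _ (two_ne_zero' ℝ)]]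
    ring
  rw [hind, lintegral_indicator measurableSet_Icc, ← ofReal_integral_eq_lintegral_ofReal,
    integral_Icc_eq_integral_Ioc, ← intervalIntegral.integral_of_le hsqrt,
    intervalIntegral.integral_eq_sub_of_hasDerivAt (fun r _ => hderiv r)
      (hcont.intervalIntegrable _ _), Real.sq_sqrt hs, ENNReal.toReal_ofReal]
  · simp [neg_div]; ring
  · simp [neg_div]; positivity
  · exact hcont.continuousOn.integrableOn_compact isCompact_Icc
  · filter_upwards [ae_restrict_mem measurableSet_Icc] with r hr
    have := hr.1
    positivity

/-- Allows the scale `σ` to be eliminated in favour of the mean gain. -/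
theorem integral_sq_rayleighMeasure {σ : ℝ} (hσ : 0 < σ) :
    ∫ r, r ^ 2 ∂(rayleighMeasure σ) = 2 * σ ^ 2 := by
  have hmeas : Measurable fun r : ℝ =>
      if 0 ≤ r then r / σ ^ 2 * Real.exp (-r ^ 2 / (2 * σ ^ 2)) else 0 :=
    Measurable.ite measurableSet_Ici (by fun_prop) measurable_const
  rw [rayleighMeasure, integral_withDensity_eq_integral_toReal_smul hmeas.ennreal_ofReal
    (ae_of_all _ fun _ => ENNReal.ofReal_lt_top)]
  have hind : (fun r : ℝ => (ENNReal.ofReal (if 0 ≤ r then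
        r / σ ^ 2 * Real.exp (-r ^ 2 / (2 * σ ^ 2)) else 0)).toReal • r ^ 2) =
      (Set.Ioi 0).indicator fun r =>
        (σ ^ 2)⁻¹ * (r ^ (3 : ℝ) * Real.exp (-(2 * σ ^ 2)⁻¹ * r ^ (2 : ℝ))) := by
    ext r
    rcases lt_trichotomy r 0 with h | h | h
    · simp [h.not_ge, h.not_gt, Set.indicator]
    · simp [h]
    · rw [Set.indicator_of_mem (Set.mem_Ioi.2 h), if_pos h.le, ENNReal.toReal_ofReal (by positivity)]
      norm_cast
      rw [smul_eq_mul, show -r ^ 2 / (2 * σ ^ 2) = -(2 * σ ^ 2)⁻¹ * r ^ 2 by ring]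
      ring
  rw [hind, integral_indicator measurableSet_Ioi, integral_const_mul,
    integral_rpow_mul_exp_neg_mul_rpow two_pos (by norm_num) (by positivity)]
  norm_num
  field_simp

section

variable {Ω : Type*}

theorem fasGain_nonneg {N : ℕ} [NeZero N] (h : Fin N → Ω → ℂ) (ω : Ω) : 0 ≤ fasGain h ω :=
  (sq_nonneg ‖h 0 ω‖).trans
    (Finset.le_sup' (fun n => channelGain (h n) ω) (Finset.mem_univ 0))

theorem fasGain_le_iff {N : ℕ} [NeZero N] {h : Fin N → Ω → ℂ} {ω : Ω} {s : ℝ} :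
    fasGain h ω ≤ s ↔ ∀ n, channelGain (h n) ω ≤ s := by
  simp [fasGain]

variable [MeasurableSpace Ω] {P : Measure Ω}

theorem IsRayleighFading.aemeasurable {h : Ω → ℂ} (hh : IsRayleighFading P h) :
    AEMeasurable (channelGain h) P := by
  obtain ⟨σ, -, hσ⟩ := hh
  exact hσ.aemeasurable.pow_const 2

theorem IsRayleighFading.integral_channelGain_pos {h : Ω → ℂ} (hh : IsRayleighFading P h) :
    0 < ∫ ω, channelGain h ω ∂P := by
  obtain ⟨σ, hσ, hlaw⟩ := hh
  have := hlaw.integral_comp (f := fun r => r ^ 2) (by fun_prop)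
  simp only [Function.comp_def] at this
  simp only [channelGain, this, integral_sq_rayleighMeasure hσ]
  positivity

/-- The gain of a Rayleigh fading channel is exponentially distributed. -/
theorem IsRayleighFading.real_channelGain_le {h : Ω → ℂ} (hh : IsRayleighFading P h)
    {s : ℝ} (hs : 0 ≤ s) :
    P.real {ω | channelGain h ω ≤ s} =
      1 - Real.exp (-(s / ∫ ω, channelGain h ω ∂P)) := by
  obtain ⟨σ, hσ, hlaw⟩ := hh
  have := hlaw.integral_comp (f := fun r => r ^ 2) (by fun_prop)
  simp only [Function.comp_def] at this
  simp only [channelGain, this, integral_sq_rayleighMeasure hσ]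
  rw [hlaw.measureReal_eq (p := fun r => r ^ 2 ≤ s)
    (measurableSet_le (by fun_prop) measurable_const), rayleighMeasure_real_sq_le hσ hs]

end

/-! ### From SINR thresholds to a gain threshold. -/

theorem lt_mul_div_mul_add_one_iff {a b c g θ : ℝ} (hb : 0 ≤ b) (hc : 0 < c)
    (hg : 0 ≤ g) (hθ : b * θ < a) :
    θ < c * a * g / (c * b * g + 1) ↔ θ / (c * (a - b * θ)) < g := by
  have h1 : 0 < c * (a - b * θ) := mul_pos hc (by linarith)
  rw [lt_div_iff₀ (by positivity), div_lt_iff₀ h1]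
  constructor <;> intro h <;> linarith

theorem sinr_gt_iff {K : ℕ} {αc : ℝ} {αp : Fin K → ℝ} (hαp : ∀ j, 0 ≤ αp j)
    (hα : αc + ∑ j, αp j = 1) {k : Fin K} {L θc θp snr g : ℝ} (hL : 0 < L)
    (hfc : (1 - αc) * θc < αc) (hfp : (1 - αc - αp k) * θp < αp k)
    (hsnr : 0 < snr) (hg : 0 ≤ g) :
    (θc < sinrCommon αc L snr g ∧ θp < sinrPrivate αp k L snr g) ↔
      gainThreshold αc (αp k) L θc θp snr < g := by
  have hsum : ∑ j ∈ Finset.univ.erase k, αp j = 1 - αc - αp k := by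
    rw [← Finset.add_sum_erase _ _ (Finset.mem_univ k)] at hα
    linarith
  have h1 : 0 ≤ 1 - αc := by
    have := Finset.sum_nonneg fun j (_ : j ∈ Finset.univ) => hαp j
    linarith
  have h2 : 0 ≤ 1 - αc - αp k := hsum ▸ Finset.sum_nonneg fun j _ => hαp j
  have hc : 0 < snr * L := mul_pos hsnr hL
  rw [gainThreshold, max_lt_iff, ← lt_mul_div_mul_add_one_iff h1 hc hg hfc,
    ← lt_mul_div_mul_add_one_iff h2 hc hg hfp, sinrCommon, sinrPrivate, hsum]
  ring_nf

theorem outageProb_eq {Ω : Type*} [MeasurableSpace Ω] {P : Measure Ω} [IsProbabilityMeasure P]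
    {K N : ℕ} [NeZero N] {αc : ℝ} {αp : Fin K → ℝ} (hαp : ∀ j, 0 ≤ αp j)
    (hα : αc + ∑ j, αp j = 1) {k : Fin K} {L θc θp snr : ℝ} (hL : 0 < L)
    (hfc : (1 - αc) * θc < αc) (hfp : (1 - αc - αp k) * θp < αp k) {h : Fin N → Ω → ℂ}
    (hmeas : ∀ n, AEMeasurable (channelGain (h n)) P) (hsnr : 0 < snr) :
    outageProb P αc αp k L θc θp h snr =
      P.real {ω | ∀ n, channelGain (h n) ω ≤ gainThreshold αc (αp k) L θc θp snr} := by
  have hset : {ω | θc < sinrCommon αc L snr (fasGain h ω) ∧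
      θp < sinrPrivate αp k L snr (fasGain h ω)} =
      {ω | ∀ n, channelGain (h n) ω ≤ gainThreshold αc (αp k) L θc θp snr}ᶜ := by
    ext ω
    rw [Set.mem_compl_iff, Set.mem_ofPred_eq, Set.mem_ofPred_eq, ← fasGain_le_iff, not_le]
    exact sinr_gt_iff hαp hα hL hfc hfp hsnr (fasGain_nonneg h ω)
  -- The gains are only a.e. measurable, so the event is only null measurable.
  rw [outageProb, hset, probReal_compl_eq_one_sub₀, sub_sub_cancel]
  rw [Set.ofPred_forall]
  exact .iInter fun n => nullMeasurableSet_le (hmeas n) aemeasurable_const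

/-! ### Scaling and small-value bounds for gamma distributions. -/

theorem isProbabilityMeasure_chiSquareMeasure {ν : ℝ} (hν : 0 < ν) :
    IsProbabilityMeasure (chiSquareMeasure ν) :=
  isProbabilityMeasure_gammaMeasure (half_pos hν) one_half_pos

/-- The powers of `l` match exactly; only the exponential factor changes, and it grows when its
argument shrinks. The factor `l` on the right is the Jacobian of the scaling. -/
theorem rpow_mul_gammaPDF_le {a r l : ℝ} (ha : 0 < a) (hr : 0 < r) (hl : 0 < l) (hl1 : l ≤ 1)
    (t : ℝ) :
    ENNReal.ofReal (l ^ a) * gammaPDF a r t ≤ ENNReal.ofReal l * gammaPDF a r (l * t) := by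
  rcases lt_or_ge t 0 with ht | ht
  · simp [gammaPDF_of_neg ht]
  have := Real.Gamma_pos_of_pos ha
  rw [gammaPDF_of_nonneg ht, gammaPDF_of_nonneg (by positivity),
    ← ENNReal.ofReal_mul (by positivity), ← ENNReal.ofReal_mul hl.le, Real.mul_rpow hl.le ht]
  refine ENNReal.ofReal_le_ofReal ?_
  have h1 : l ^ a = l * l ^ (a - 1) := by
    rw [Real.rpow_sub_one hl.ne']; field_simp
  have h2 : Real.exp (-(r * t)) ≤ Real.exp (-(r * (l * t))) := by
    refine Real.exp_le_exp.2 (neg_le_neg ?_)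
    exact mul_le_mul_of_nonneg_left (mul_le_of_le_one_left ht hl1) hr.le
  calc l ^ a * (r ^ a / Real.Gamma a * t ^ (a - 1) * Real.exp (-(r * t)))
      = l * (r ^ a / Real.Gamma a * (l ^ (a - 1) * t ^ (a - 1)) * Real.exp (-(r * t))) := by
        rw [h1]; ring
    _ ≤ _ := by gcongr

/-- Scaling a gamma distribution down by `l` costs at most a factor `l ^ a`. -/
theorem rpow_smul_gammaMeasure_le_map {a r l : ℝ} (ha : 0 < a) (hr : 0 < r) (hl : 0 < l)
    (hl1 : l ≤ 1) :
    ENNReal.ofReal (l ^ a) • gammaMeasure a r ≤ (gammaMeasure a r).map (l⁻¹ * ·) := by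
  refine Measure.le_iff.2 fun s hs => ?_
  have hpdf : Measurable (gammaPDF a r) := (measurable_gammaPDFReal a r).ennreal_ofReal
  have hs' : MeasurableSet ((l⁻¹ * ·) ⁻¹' s) := hs.preimage (by fun_prop)
  have hscale : ∫⁻ t, ((l⁻¹ * ·) ⁻¹' s).indicator (gammaPDF a r) t =
      ENNReal.ofReal l * ∫⁻ t, ((l⁻¹ * ·) ⁻¹' s).indicator (gammaPDF a r) (l * t) := by
    conv_lhs => rw [← Real.smul_map_volume_mul_left hl.ne', abs_of_pos hl]
    rw [lintegral_smul_measure, lintegral_map (hpdf.indicator hs') (by fun_prop), smul_eq_mul]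
  rw [Measure.map_apply (by fun_prop) hs, Measure.smul_apply, smul_eq_mul, gammaMeasure,
    withDensity_apply _ hs, withDensity_apply _ hs', ← lintegral_indicator hs,
    ← lintegral_indicator hs', hscale, ← lintegral_const_mul _ (hpdf.indicator hs),
    ← lintegral_const_mul _ (f := fun t => ((l⁻¹ * ·) ⁻¹' s).indicator (gammaPDF a r) (l * t))
      ((hpdf.indicator hs').comp (measurable_const_mul l))]
  refine lintegral_mono fun t => ?_
  have hmem : l * t ∈ (l⁻¹ * ·) ⁻¹' s ↔ t ∈ s := by simp [hl.ne']
  by_cases ht : t ∈ s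
  · simpa [Set.indicator_of_mem ht, Set.indicator_of_mem (hmem.2 ht)] using
      rpow_mul_gammaPDF_le ha hr hl hl1 t
  · simp [Set.indicator_of_notMem ht]

/-- Bound the exponential factor of the density by `1` and integrate the power. -/
theorem exists_gammaMeasure_Iic_le {a r : ℝ} (ha : 0 < a) (hr : 0 < r) :
    ∃ C : ℝ, 0 ≤ C ∧ ∀ x, 0 ≤ x → gammaMeasure a r (Set.Iic x) ≤ ENNReal.ofReal (C * x ^ a) := by
  have := Real.Gamma_pos_of_pos ha
  refine ⟨r ^ a / Real.Gamma a / a, by positivity, fun x hx => ?_⟩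
  have hint : IntervalIntegrable (fun t : ℝ => t ^ (a - 1)) volume 0 x :=
    intervalIntegral.intervalIntegrable_rpow' (by linarith)
  rw [gammaMeasure, withDensity_apply _ measurableSet_Iic,
    lintegral_Iic_eq_lintegral_Iio_add_Icc _ hx, lintegral_gammaPDF_of_nonpos le_rfl, zero_add,
    Measure.restrict_congr_set Ioc_ae_eq_Icc.symm]
  have hI : r ^ a / Real.Gamma a / a * x ^ a =
      ∫ t in Set.Ioc 0 x, r ^ a / Real.Gamma a * t ^ (a - 1) := by
    rw [integral_const_mul, ← intervalIntegral.integral_of_le hx,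
      integral_rpow (.inl (by linarith)), sub_add_cancel, Real.zero_rpow ha.ne']
    ring
  rw [hI, ofReal_integral_eq_lintegral_ofReal]
  · refine setLIntegral_mono' measurableSet_Ioc fun t ht => ?_
    have ht0 := ht.1
    rw [gammaPDF_of_nonneg ht0.le]
    refine ENNReal.ofReal_le_ofReal (mul_le_of_le_one_right (by positivity) ?_)
    exact Real.exp_le_one_iff.2 (neg_nonpos.2 (by positivity))
  · exact ((intervalIntegrable_iff_integrableOn_Ioc_of_le hx).1 hint).const_mul _
  · filter_upwards [ae_restrict_mem measurableSet_Ioc] with t ht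
    have := ht.1
    positivity

theorem ae_chiSquareMeasure_pos {ν : ℝ} (hν : 0 < ν) : ∀ᵐ w ∂chiSquareMeasure ν, 0 < w := by
  obtain ⟨C, -, hC⟩ := exists_gammaMeasure_Iic_le (half_pos hν) (one_half_pos (α := ℝ))
  have h0 := hC 0 le_rfl
  rw [Real.zero_rpow (half_pos hν).ne', mul_zero, ENNReal.ofReal_zero] at h0
  rw [ae_iff]
  simp only [not_lt]
  exact le_antisymm h0 bot_le

/-! ### Lower tails of `t` distributions. -/

section

variable {E : Type*} [MeasurableSpace E] {κ : Measure E}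

/-- The lower tail, at level `-r`, of a family of random variables divided by a common independent
`√(W / ν)`, `W ∼ χ²(ν)`, decays at most as fast as `r ^ (-ν)`. -/
theorem rpow_mul_prod_chiSquareMeasure_le [IsFiniteMeasure κ] {ι : Type*} [Countable ι]
    {X : ι → E → ℝ} (hX : ∀ i, Measurable (X i)) {ν : ℝ} (hν : 0 < ν) {r r' : ℝ} (hr : 0 < r)
    (hrr' : r ≤ r') :
    r ^ ν * (κ.prod (chiSquareMeasure ν)).real {p | ∀ i, X i p.1 / √(p.2 / ν) ≤ -r} ≤
      r' ^ ν * (κ.prod (chiSquareMeasure ν)).real {p | ∀ i, X i p.1 / √(p.2 / ν) ≤ -r'} := by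
  have := isProbabilityMeasure_chiSquareMeasure hν
  have hr' : 0 < r' := hr.trans_le hrr'
  have hmeas : ∀ t : ℝ, MeasurableSet {p : E × ℝ | ∀ i, X i p.1 / √(p.2 / ν) ≤ t} := by
    intro t
    simp only [Set.ofPred_forall]
    exact .iInter fun i => measurableSet_le (by fun_prop) measurable_const
  -- Dividing `W` by this `l` multiplies `√(W / ν)` by `r' / r`, which turns level `-r` into level
  -- `-r'`.
  set l : ℝ := (r / r') ^ 2 with hl
  have hl0 : 0 < l := by positivity
  have hl1 : l ≤ 1 := pow_le_one₀ (by positivity) ((div_le_one hr').2 hrr')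
  have hla : l ^ (ν / 2) = r ^ ν / r' ^ ν := by
    rw [hl, ← Real.rpow_natCast, ← Real.rpow_mul (by positivity), Nat.cast_two,
      mul_div_cancel₀ _ two_ne_zero, Real.div_rpow hr.le hr'.le]
  have hle : ENNReal.ofReal (l ^ (ν / 2)) *
      (κ.prod (chiSquareMeasure ν)) {p | ∀ i, X i p.1 / √(p.2 / ν) ≤ -r} ≤
      (κ.prod (chiSquareMeasure ν)) {p | ∀ i, X i p.1 / √(p.2 / ν) ≤ -r'} := by
    rw [Measure.prod_apply (hmeas _), Measure.prod_apply (hmeas _),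
      ← lintegral_const_mul _ (measurable_measure_prodMk_left (hmeas _))]
    refine lintegral_mono fun z => ?_
    have hz := rpow_smul_gammaMeasure_le_map (half_pos hν) (one_half_pos (α := ℝ)) hl0 hl1
      (Prod.mk z ⁻¹' {p | ∀ i, X i p.1 / √(p.2 / ν) ≤ -r})
    rw [Measure.map_apply (by fun_prop) ((hmeas _).preimage measurable_prodMk_left)] at hz
    refine hz.trans (measure_mono fun w hw i => ?_)
    have hwi : X i z / √(l⁻¹ * w / ν) ≤ -r := hw i
    rw [mul_div_assoc, Real.sqrt_mul (by positivity), Real.sqrt_inv, hl,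
      Real.sqrt_sq (by positivity)] at hwi
    have heq : X i z / ((r / r')⁻¹ * √(w / ν)) = X i z / √(w / ν) * (r / r') := by
      rw [div_mul_eq_div_div, div_inv_eq_mul]; ring
    rw [heq, ← le_div_iff₀ (by positivity)] at hwi
    refine hwi.trans_eq ?_
    field_simp
  have hreal := ENNReal.toReal_mono (measure_ne_top _ _) hle
  rw [ENNReal.toReal_mul, ENNReal.toReal_ofReal (by positivity), hla, div_mul_eq_mul_div,
    div_le_iff₀ (by positivity), mul_comm _ (r' ^ ν)] at hreal
  exact hreal

end

theorem rpow_mul_multivariateTMeasure_le {N : ℕ} (S : Matrix (Fin N) (Fin N) ℝ) {ν : ℝ}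
    (hν : 0 < ν) {r r' : ℝ} (hr : 0 < r) (hrr' : r ≤ r') :
    r ^ ν * (multivariateTMeasure ν S).real {y | ∀ i, y i ≤ -r} ≤
      r' ^ ν * (multivariateTMeasure ν S).real {y | ∀ i, y i ≤ -r'} := by
  have hmeas : ∀ t : ℝ, MeasurableSet {y : Fin N → ℝ | ∀ i, y i ≤ t} := fun t => by
    simp only [Set.ofPred_forall]
    exact .iInter fun i => measurableSet_le (by fun_prop) measurable_const
  rw [multivariateTMeasure, map_measureReal_apply (by fun_prop) (hmeas _),
    map_measureReal_apply (by fun_prop) (hmeas _)]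
  exact rpow_mul_prod_chiSquareMeasure_le (X := fun i (z : EuclideanSpace ℝ (Fin N)) => z i)
    (fun i => by fun_prop) hν hr hrr'

theorem rpow_mul_studentTMeasure_Iic_le {ν : ℝ} (hν : 0 < ν) {r r' : ℝ} (hr : 0 < r)
    (hrr' : r ≤ r') :
    r ^ ν * (studentTMeasure ν).real (Set.Iic (-r)) ≤
      r' ^ ν * (studentTMeasure ν).real (Set.Iic (-r')) := by
  rw [studentTMeasure, map_measureReal_apply (by fun_prop) measurableSet_Iic,
    map_measureReal_apply (by fun_prop) measurableSet_Iic]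
  simpa [Set.preimage] using rpow_mul_prod_chiSquareMeasure_le (ι := Unit) (κ := gaussianReal 0 1)
    (X := fun _ z => z) (fun _ => measurable_id) hν hr hrr'

theorem isProbabilityMeasure_studentTMeasure {ν : ℝ} (hν : 0 < ν) :
    IsProbabilityMeasure (studentTMeasure ν) := by
  have := isProbabilityMeasure_chiSquareMeasure hν
  exact Measure.isProbabilityMeasure_map (by fun_prop)

/-- For given `Z = z`, the tail event forces `W ≤ ν * (|z| / r) ^ 2`, of probability `O(|z| ^ ν / r
^ ν)`; Gaussian absolute moments are finite. -/
theorem exists_rpow_mul_studentTMeasure_Iic_le {ν : ℝ} (hν : 0 < ν) :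
    ∃ K : ℝ, ∀ r, 0 < r → r ^ ν * (studentTMeasure ν).real (Set.Iic (-r)) ≤ K := by
  have := isProbabilityMeasure_chiSquareMeasure hν
  obtain ⟨C, hC0, hC⟩ := exists_gammaMeasure_Iic_le (half_pos hν) (one_half_pos (α := ℝ))
  have hint : Integrable (fun z : ℝ => |z| ^ ν) (gaussianReal 0 1) := by
    have := (memLp_id_gaussianReal (μ := 0) (v := 1) ν.toNNReal).integrable_norm_rpow
      (by simpa using hν) (by simp)
    simpa [hν.le] using this
  refine ⟨C * ν ^ (ν / 2) * ∫ z, |z| ^ ν ∂gaussianReal 0 1, fun r hr => ?_⟩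
  have hmeas : MeasurableSet ((fun p : ℝ × ℝ => p.1 / √(p.2 / ν)) ⁻¹' Set.Iic (-r)) :=
    measurableSet_Iic.preimage (by fun_prop)
  have hle : studentTMeasure ν (Set.Iic (-r)) ≤
      ∫⁻ z, ENNReal.ofReal (C * ν ^ (ν / 2) / r ^ ν * |z| ^ ν) ∂gaussianReal 0 1 := by
    rw [studentTMeasure, Measure.map_apply (by fun_prop) measurableSet_Iic,
      Measure.prod_apply hmeas]
    refine lintegral_mono fun z => ?_
    have hsub : Prod.mk z ⁻¹' ((fun p : ℝ × ℝ => p.1 / √(p.2 / ν)) ⁻¹' Set.Iic (-r)) ⊆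
        Set.Iic (ν * (|z| / r) ^ 2) := by
      intro w hw
      have hw' : z / √(w / ν) ≤ -r := hw
      rcases le_or_gt w 0 with h0 | h0
      · exact h0.trans (by positivity)
      · have hs : 0 < √(w / ν) := Real.sqrt_pos.2 (by positivity)
        rw [div_le_iff₀ hs] at hw'
        have h1 : √(w / ν) ≤ |z| / r := by
          rw [le_div_iff₀ hr]
          have := neg_le_abs z
          linarith
        have h2 := (Real.sqrt_le_left (by positivity)).1 h1
        rw [div_le_iff₀ hν] at h2
        rw [Set.mem_Iic]
        linarith
    refine (measure_mono hsub).trans ((hC _ (by positivity)).trans_eq ?_)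
    congr 1
    rw [Real.mul_rpow hν.le (by positivity), ← Real.rpow_natCast, ← Real.rpow_mul (by positivity),
      Nat.cast_two, mul_div_cancel₀ _ two_ne_zero, Real.div_rpow (abs_nonneg z) hr.le]
    ring
  rw [← ofReal_integral_eq_lintegral_ofReal (hint.const_mul _)
    (ae_of_all _ fun z => by positivity), integral_const_mul] at hle
  have hreal := ENNReal.toReal_mono ENNReal.ofReal_ne_top hle
  rw [ENNReal.toReal_ofReal (mul_nonneg (by positivity) (integral_nonneg fun z => by positivity)),
    div_mul_eq_mul_div, le_div_iff₀ (by positivity), mul_comm _ (r ^ ν)] at hreal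
  exact hreal

/-- For each fixed `w > 0` the event is a Gaussian half-line. This is what makes the tail constant
`ℓ` nonzero. -/
theorem studentTMeasure_Iic_pos {ν : ℝ} (hν : 0 < ν) (x : ℝ) :
    0 < (studentTMeasure ν).real (Set.Iic x) := by
  have := isProbabilityMeasure_chiSquareMeasure hν
  have := isProbabilityMeasure_studentTMeasure hν
  have hmeas : MeasurableSet ((fun p : ℝ × ℝ => p.1 / √(p.2 / ν)) ⁻¹' Set.Iic x) :=
    measurableSet_Iic.preimage (by fun_prop)
  rw [measureReal_def, ENNReal.toReal_pos_iff]
  refine ⟨pos_iff_ne_zero.2 fun h0 => ?_, measure_lt_top _ _⟩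
  rw [studentTMeasure, Measure.map_apply (by fun_prop) measurableSet_Iic,
    Measure.prod_apply_symm hmeas,
    lintegral_eq_zero_iff (measurable_measure_prodMk_right hmeas)] at h0
  obtain ⟨w, hw, hw0⟩ := (h0.and (ae_chiSquareMeasure_pos hν)).exists
  have hs : 0 < √(w / ν) := Real.sqrt_pos.2 (by positivity)
  have hset : (fun z => (z, w)) ⁻¹' ((fun p : ℝ × ℝ => p.1 / √(p.2 / ν)) ⁻¹' Set.Iic x) =
      Set.Iic (x * √(w / ν)) := by
    ext z
    simp [div_le_iff₀ hs]
  simp only [hset, Pi.zero_apply] at hw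
  have := gaussianReal_absolutelyContinuous' 0 one_ne_zero hw
  simp at this

theorem studentTMeasure_singleton {ν : ℝ} (hν : 0 < ν) (x : ℝ) :
    studentTMeasure ν {x} = 0 := by
  have := isProbabilityMeasure_chiSquareMeasure hν
  have hmeas : MeasurableSet ((fun p : ℝ × ℝ => p.1 / √(p.2 / ν)) ⁻¹' {x}) :=
    (measurableSet_singleton x).preimage (by fun_prop)
  rw [studentTMeasure, Measure.map_apply (by fun_prop) (measurableSet_singleton x),
    Measure.prod_apply_symm hmeas,
    lintegral_eq_zero_iff (measurable_measure_prodMk_right hmeas)]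
  filter_upwards [ae_chiSquareMeasure_pos hν] with w hw
  have hs : 0 < √(w / ν) := Real.sqrt_pos.2 (by positivity)
  have hset : (fun z => (z, w)) ⁻¹' ((fun p : ℝ × ℝ => p.1 / √(p.2 / ν)) ⁻¹' {x}) =
      {x * √(w / ν)} := by
    ext z
    simp [div_eq_iff hs.ne']
  rw [hset]
  exact gaussianReal_absolutelyContinuous 0 one_ne_zero Real.volume_singleton

/-! ### The `t` quantile function. -/

theorem continuous_cdf_of_nullSingletonClass (μ : Measure ℝ) [IsProbabilityMeasure μ]
    [NullSingletonClass μ] : Continuous (cdf μ) := by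
  refine continuous_iff_continuousAt.2 fun x => ?_
  rw [(monotone_cdf μ).continuousAt_iff_leftLim_eq_rightLim, (cdf μ).rightLim_eq]
  have h := (cdf μ).measure_singleton x
  rw [measure_cdf, measure_singleton, eq_comm, ENNReal.ofReal_eq_zero, sub_nonpos] at h
  exact le_antisymm ((monotone_cdf μ).leftLim_le le_rfl) h

/-- Without atoms the distribution function is continuous, so the infimum is attained and the level
`p` is hit exactly. -/
theorem exists_tQuantile_eq_coe {ν : ℝ} (hν : 0 < ν) {p : ℝ} (hp0 : 0 < p) (hp1 : p < 1) :
    ∃ q : ℝ, tQuantile ν p = q ∧ (studentTMeasure ν).real (Set.Iic q) = p := by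
  have := isProbabilityMeasure_studentTMeasure hν
  have : NullSingletonClass (studentTMeasure ν) := ⟨studentTMeasure_singleton hν⟩
  set F := cdf (studentTMeasure ν) with hF
  have hcont : Continuous F := continuous_cdf_of_nullSingletonClass _
  obtain ⟨b, hb⟩ := ((tendsto_cdf_atTop (studentTMeasure ν)).eventually_const_le hp1).exists
  obtain ⟨a, ha⟩ := ((tendsto_cdf_atBot (studentTMeasure ν)).eventually_lt_const hp0).exists
  have hclosed : IsClosed {x | p ≤ F x} := isClosed_le continuous_const hcont
  have hbdd : BddBelow {x | p ≤ F x} :=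
    ⟨a, fun x hx => le_of_lt ((monotone_cdf _).reflect_lt (ha.trans_le hx))⟩
  have hleast : IsLeast {x | p ≤ F x} (sInf {x | p ≤ F x}) :=
    ⟨hclosed.csInf_mem ⟨b, hb⟩ hbdd, fun x hx => csInf_le hbdd hx⟩
  set q := sInf {x | p ≤ F x}
  obtain ⟨x₀, hx₀⟩ := mem_range_of_exists_le_of_exists_ge hcont ⟨a, ha.le⟩ ⟨b, hb⟩
  refine ⟨q, ?_, ?_⟩
  · refine IsLeast.csInf_eq ⟨⟨q, rfl, ?_⟩, ?_⟩
    · rw [← cdf_eq_real]; exact hleast.1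
    · rintro _ ⟨x, rfl, hx⟩
      rw [← cdf_eq_real] at hx
      exact EReal.coe_le_coe_iff.2 (hleast.2 hx)
  · rw [← cdf_eq_real]
    exact le_antisymm ((monotone_cdf _ (hleast.2 hx₀.ge)).trans hx₀.le) hleast.1

theorem tQuantile_mono (ν : ℝ) : Monotone (tQuantile ν) := by
  intro p p' hpp'
  refine sInf_le_sInf ?_
  rintro _ ⟨x, rfl, hx⟩
  exact ⟨x, rfl, hpp'.trans hx⟩

theorem isProbabilityMeasure_multivariateTMeasure {N : ℕ} (S : Matrix (Fin N) (Fin N) ℝ) {ν : ℝ}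
    (hν : 0 < ν) : IsProbabilityMeasure (multivariateTMeasure ν S) := by
  have := isProbabilityMeasure_chiSquareMeasure hν
  exact Measure.isProbabilityMeasure_map (by fun_prop)

theorem multivariateTCDF_mono {N : ℕ} (S : Matrix (Fin N) (Fin N) ℝ) {ν : ℝ} (hν : 0 < ν) :
    Monotone (multivariateTCDF ν S) := by
  have := isProbabilityMeasure_multivariateTMeasure S hν
  intro x y hxy
  exact measureReal_mono fun z hz i => (hz i).trans (hxy i)

/-! ### Power-law asymptotics of tails, quantiles and the copula diagonal. -/

theorem exists_tendsto_rpow_mul_studentTMeasure_Iic {ν : ℝ} (hν : 0 < ν) :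
    ∃ ℓ : ℝ, 0 < ℓ ∧
      Tendsto (fun r : ℝ => r ^ ν * (studentTMeasure ν).real (Set.Iic (-r))) atTop (𝓝 ℓ) := by
  obtain ⟨K, hK⟩ := exists_rpow_mul_studentTMeasure_Iic_le hν
  set φ : ℝ → ℝ := fun r => r ^ ν * (studentTMeasure ν).real (Set.Iic (-r)) with hφ
  -- Monotonicity is known only for positive `r`; the truncation at `1` makes it global without
  -- affecting the limit.
  have hmono : Monotone fun r => φ (max r 1) := fun r r' hrr' =>
    rpow_mul_studentTMeasure_Iic_le hν (by positivity) (max_le_max_right 1 hrr')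
  have hbdd : BddAbove (Set.range fun r => φ (max r 1)) := by
    refine ⟨K, ?_⟩
    rintro _ ⟨r, rfl⟩
    exact hK _ (by positivity)
  refine ⟨⨆ r, φ (max r 1), ?_, ?_⟩
  · refine lt_of_lt_of_le ?_ (le_ciSup hbdd 1)
    simpa [hφ] using studentTMeasure_Iic_pos hν (-1)
  · refine (tendsto_atTop_ciSup hmono hbdd).congr' ?_
    filter_upwards [eventually_ge_atTop 1] with r hr
    rw [max_eq_left hr]

/-- The lower `t` quantile of order `p` has order of magnitude `p ^ (-1 / ν)`. -/
theorem tendsto_neg_tQuantile {ν : ℝ} (hν : 0 < ν) :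
    Tendsto (fun p => -(tQuantile ν p).toReal) (𝓝[>] 0) atTop := by
  have := isProbabilityMeasure_studentTMeasure hν
  refine tendsto_atTop.2 fun M => ?_
  filter_upwards [Ioo_mem_nhdsGT one_pos,
    Ioo_mem_nhdsGT (studentTMeasure_Iic_pos hν (-M))] with p hp hpM
  obtain ⟨q, hq, hFq⟩ := exists_tQuantile_eq_coe hν hp.1 hp.2
  rw [hq, EReal.toReal_coe, le_neg]
  by_contra! hlt
  have := measureReal_mono (μ := studentTMeasure ν) (Set.Iic_subset_Iic.2 hlt.le)
  linarith [hpM.2]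

/-- The tail limit, evaluated at the quantile, where the tail probability is exactly `p`. -/
theorem exists_tendsto_neg_tQuantile_rpow_mul {ν : ℝ} (hν : 0 < ν) :
    ∃ ℓ : ℝ, 0 < ℓ ∧ Tendsto (fun p => (-(tQuantile ν p).toReal) ^ ν * p) (𝓝[>] 0) (𝓝 ℓ) := by
  obtain ⟨ℓ, hℓ, hlim⟩ := exists_tendsto_rpow_mul_studentTMeasure_Iic hν
  refine ⟨ℓ, hℓ, (hlim.comp (tendsto_neg_tQuantile hν)).congr' ?_⟩
  filter_upwards [Ioo_mem_nhdsGT one_pos] with p hp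
  obtain ⟨q, hq, hFq⟩ := exists_tQuantile_eq_coe hν hp.1 hp.2
  simp [hq, hFq]

/-- Asymptotically equivalent small probabilities give asymptotically equivalent values on the
diagonal of the `t` copula. -/
theorem isEquivalent_multivariateTCDF_tQuantile {α : Type*} {l : Filter α} {N : ℕ}
    (S : Matrix (Fin N) (Fin N) ℝ) {ν : ℝ} (hν : 0 < ν) {u v : α → ℝ}
    (hu : Tendsto u l (𝓝[>] 0)) (hv : Tendsto v l (𝓝[>] 0)) (hvu : ∀ᶠ a in l, v a ≤ u a)
    (hequiv : v ~[l] u) :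
    (fun a => multivariateTCDF ν S fun _ => tQuantile ν (v a)) ~[l]
      fun a => multivariateTCDF ν S fun _ => tQuantile ν (u a) := by
  obtain ⟨ℓ, hℓ, hlim⟩ := exists_tendsto_neg_tQuantile_rpow_mul hν
  set r : ℝ → ℝ := fun p => -(tQuantile ν p).toReal with hr
  have hupos : ∀ᶠ a in l, 0 < u a := hu self_mem_nhdsWithin
  have hvpos : ∀ᶠ a in l, 0 < v a := hv self_mem_nhdsWithin
  -- Both `r(u) ^ ν * u` and `r(v) ^ ν * v` tend to the same `ℓ ≠ 0`, and `v / u → 1`.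
  have hratio : Tendsto (fun a => r (u a) ^ ν / r (v a) ^ ν) l (𝓝 1) := by
    have h1 : Tendsto (v / u) l (𝓝 1) :=
      (isEquivalent_iff_tendsto_one (hupos.mono fun a ha => ha.ne')).1 hequiv
    have h2 := ((hlim.comp hu).div (hlim.comp hv) hℓ.ne').mul h1
    rw [div_self hℓ.ne', one_mul] at h2
    refine h2.congr' ?_
    filter_upwards [hupos, hvpos] with a hua hva
    simp only [Function.comp_apply, Pi.div_apply]
    field_simp
    rfl
  have hcdf : ∀ p, 0 < p → p < 1 → (multivariateTCDF ν S fun _ => tQuantile ν p) =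
      (multivariateTMeasure ν S).real {y | ∀ i, y i ≤ -r p} := by
    intro p hp0 hp1
    obtain ⟨q, hq, -⟩ := exists_tQuantile_eq_coe hν hp0 hp1
    simp [multivariateTCDF, hr, hq]
  -- The bound is kept multiplicative because the copula value may vanish, for instance with two
  -- ports of correlation `-1`.
  refine isLittleO_iff.2 fun c hc => ?_
  filter_upwards [hupos, hvpos, hvu, hu (Ioo_mem_nhdsGT one_pos),
    hratio.eventually_const_le (sub_lt_self 1 hc), (tendsto_neg_tQuantile hν).comp hu
    |>.eventually_gt_atTop 0, (tendsto_neg_tQuantile hν).comp hv |>.eventually_gt_atTop 0]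
    with a hua hva hvua hu1 hc1 hru hrv
  have hle : (multivariateTCDF ν S fun _ => tQuantile ν (v a)) ≤
      multivariateTCDF ν S fun _ => tQuantile ν (u a) :=
    multivariateTCDF_mono S hν fun _ => tQuantile_mono ν hvua
  have hnonneg : 0 ≤ multivariateTCDF ν S fun _ => tQuantile ν (u a) := measureReal_nonneg
  obtain ⟨qu, hqu, -⟩ := exists_tQuantile_eq_coe hν hua hu1.2
  obtain ⟨qv, hqv, -⟩ := exists_tQuantile_eq_coe hν hva (hvua.trans_lt hu1.2)
  have hrr : r (u a) ≤ r (v a) := by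
    have := tQuantile_mono ν hvua
    rw [hqu, hqv, EReal.coe_le_coe_iff] at this
    simpa [hr, hqu, hqv] using this
  -- Lower half of the squeeze: `C(v) ≥ (r(u) / r(v)) ^ ν * C(u) ≥ (1 - c) * C(u)`.
  have hscale := rpow_mul_multivariateTMeasure_le S hν hru hrr
  have hrvν : 0 < r (v a) ^ ν := Real.rpow_pos_of_pos hrv ν
  rw [Function.comp_apply, ← hcdf _ hua hu1.2, ← hcdf _ hva (hvua.trans_lt hu1.2),
    ← div_le_iff₀' hrvν, mul_div_right_comm] at hscale
  have hbound := mul_le_mul_of_nonneg_right hc1 hnonneg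
  rw [Pi.sub_apply, Real.norm_of_nonpos (sub_nonpos.2 hle), Real.norm_of_nonneg hnonneg]
  linarith

/-! ### High-SNR limit and conclusion. -/

theorem isEquivalent_one_sub_exp_neg : (fun u : ℝ => 1 - Real.exp (-u)) ~[𝓝 0] id := by
  have h : HasDerivAt (fun u : ℝ => 1 - Real.exp (-u)) 1 0 := by
    simpa using (((hasDerivAt_id (0 : ℝ)).neg).exp.const_sub 1)
  have := hasDerivAt_iff_isLittleO.1 h
  simpa [IsEquivalent, Pi.sub_def, Function.id_def] using this

/-- Shows that the threshold vanishes as the SNR grows. -/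
theorem gainThreshold_eq_div {αc αpk L θc θp snr : ℝ} (hsnr : 0 < snr) :
    gainThreshold αc αpk L θc θp snr = gainThreshold αc αpk L θc θp 1 / snr := by
  rw [gainThreshold, gainThreshold, ← max_div_div_right hsnr.le]
  congr 1 <;> rw [one_mul, div_div] <;> congr 1 <;> ring

theorem gainThreshold_pos {αc αpk L θc θp snr : ℝ} (hL : 0 < L) (hθc : 0 < θc)
    (hfc : (1 - αc) * θc < αc) (hsnr : 0 < snr) : 0 < gainThreshold αc αpk L θc θp snr :=
  lt_max_of_lt_left (div_pos hθc (mul_pos (mul_pos hsnr hL) (sub_pos.2 hfc)))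

theorem corollary1
    {Ω : Type*} [MeasurableSpace Ω] (P : Measure Ω) [IsProbabilityMeasure P]
    -- power allocation among the common message and the private messages of the `K` users
    {K : ℕ} (αc : ℝ) (αp : Fin K → ℝ) (hαp : ∀ j, 0 ≤ αp j) (hα : αc + ∑ j, αp j = 1)
    -- the user, the path loss exponent, the positions of the base station and of the user
    (k : Fin K) (β : ℝ) (hβ : 2 < β) (x₀ x : EuclideanSpace ℝ (Fin 3)) (hx : x₀ ≠ x)
    -- SINR thresholds, attainable in the absence of noise
    (θc θp : ℝ) (hθc : 0 < θc) (hθp : 0 < θp)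
    (hfc : (1 - αc) * θc < αc) (hfp : (1 - αc - αp k) * θp < αp k)
    -- the ports of the user: Rayleigh fading of mean power `gbar`, coupled by a `t` copula
    {N : ℕ} [NeZero N] (h : Fin N → Ω → ℂ) (hray : ∀ n, IsRayleighFading P (h n))
    (gbar : ℝ) (hgbar : ∀ n, ∫ ω, channelGain (h n) ω ∂P = gbar)
    (ν : ℝ) (hν : 0 < ν) (S : Matrix (Fin N) (Fin N) ℝ) (hS : IsCorrelationMatrix S)
    (hcop : HasTCopula P ν S fun n => channelGain (h n)) :
    -- the outage probability is the copula at the exponential marginals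
    (∀ snr : ℝ, 0 < snr →
      outageProb P αc αp k (pathLoss β x₀ x) θc θp h snr =
        multivariateTCDF ν S fun _ => tQuantile ν
          (1 - Real.exp (-(gainThreshold αc (αp k) (pathLoss β x₀ x) θc θp snr / gbar)))) ∧
    -- first-order behaviour of the marginal distribution functions at high SNR
    (∀ n, (fun snr : ℝ => P.real {ω | channelGain (h n) ω ≤
          gainThreshold αc (αp k) (pathLoss β x₀ x) θc θp snr}) ~[atTop]
        fun snr => gainThreshold αc (αp k) (pathLoss β x₀ x) θc θp snr / gbar) ∧
    -- the outage probability is asymptotically equivalent to the copula at the first-order terms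
    (fun snr : ℝ => outageProb P αc αp k (pathLoss β x₀ x) θc θp h snr) ~[atTop]
      fun snr => multivariateTCDF ν S fun _ => tQuantile ν
        (gainThreshold αc (αp k) (pathLoss β x₀ x) θc θp snr / gbar) := by
  have hL : 0 < pathLoss β x₀ x := Real.rpow_pos_of_pos (dist_pos.2 hx) _
  have hgbar_pos : 0 < gbar := hgbar 0 ▸ (hray 0).integral_channelGain_pos
  set g := gainThreshold αc (αp k) (pathLoss β x₀ x) θc θp with hg
  have hg_pos : ∀ snr, 0 < snr → 0 < g snr := fun snr => gainThreshold_pos hL hθc hfc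
  have hmarginal : ∀ n snr, 0 < snr →
      P.real {ω | channelGain (h n) ω ≤ g snr} = 1 - Real.exp (-(g snr / gbar)) := by
    intro n snr hsnr
    rw [(hray n).real_channelGain_le (hg_pos snr hsnr).le, hgbar n]
  have hout : ∀ snr : ℝ, 0 < snr → outageProb P αc αp k (pathLoss β x₀ x) θc θp h snr =
      multivariateTCDF ν S fun _ => tQuantile ν (1 - Real.exp (-(g snr / gbar))) := by
    intro snr hsnr
    rw [outageProb_eq hαp hα hL hfc hfp (fun n => (hray n).aemeasurable) hsnr,
      hcop fun _ => g snr, tCopula]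
    simp only [hmarginal _ snr hsnr]
  have hu : Tendsto (fun snr => g snr / gbar) atTop (𝓝[>] 0) := by
    refine tendsto_nhdsWithin_iff.2 ⟨?_, ?_⟩
    · have : Tendsto (fun snr : ℝ => g 1 / snr / gbar) atTop (𝓝 0) := by
        simpa using (tendsto_const_nhds.div_atTop tendsto_id).div_const gbar
      refine this.congr' ?_
      filter_upwards [eventually_gt_atTop 0] with snr hsnr
      rw [hg, ← gainThreshold_eq_div hsnr]
    · filter_upwards [eventually_gt_atTop 0] with snr hsnr
      exact div_pos (hg_pos snr hsnr) hgbar_pos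
  have hequiv : (fun snr => 1 - Real.exp (-(g snr / gbar))) ~[atTop] fun snr => g snr / gbar :=
    isEquivalent_one_sub_exp_neg.comp_tendsto (hu.mono_right nhdsWithin_le_nhds)
  -- This ordering supplies the upper half of the squeeze.
  have hle : ∀ snr, 1 - Real.exp (-(g snr / gbar)) ≤ g snr / gbar := fun snr => by
    linarith [Real.add_one_le_exp (-(g snr / gbar))]
  have hv : Tendsto (fun snr => 1 - Real.exp (-(g snr / gbar))) atTop (𝓝[>] 0) := by
    refine tendsto_nhdsWithin_iff.2
      ⟨hequiv.symm.tendsto_nhds (hu.mono_right nhdsWithin_le_nhds), ?_⟩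
    filter_upwards [hu self_mem_nhdsWithin] with snr hsnr
    exact sub_pos.2 (Real.exp_lt_one_iff.2 (neg_lt_zero.2 hsnr))
  refine ⟨hout, fun n => hequiv.congr_left ?_, ?_⟩
  · filter_upwards [eventually_gt_atTop 0] with snr hsnr
    exact (hmarginal n snr hsnr).symm
  · refine (isEquivalent_multivariateTCDF_tQuantile S hν hu hv (.of_forall hle)
      hequiv).congr_left ?_
    filter_upwards [eventually_gt_atTop 0] with snr hsnr
    exact (hout snr hsnr).symm
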